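/- Let $M$ be a compact connected complex manifold with trivial canonical bundle, let $\sigma$ be a nowhere zero holomorphic form of top degree on $M$, and let $f$ be a holomorphic automorphism of $M$. (In particular $M$ may be a simply connected compact Kähler manifold with trivial canonical bundle, and $f$ may have infinite order.) Let $V$ be a complex vector space of finite dimension $p\ge 1$, let $\Gamma\subset V$ be a lattice, and let $(\gamma_i)_i$ be a $\mathbb Z$-basis of $\Gamma$; for $\gamma=\sum_i a_i\gamma_i\in\Gamma$ put $\deg\gamma=\sum_i a_i$. Let $\Gamma$ act on $M\times V$ by $$\gamma\cdot(z,t)=\bigl(f^{\deg\gamma}(z),\,t+\gamma\bigr),$$ and let $X=(M\times V)/\Gamma$ be the quotient complex manifold. Then there is a unique complex number $\lambda$ with $f^*\sigma=\lambda\sigma$, it satisfies $|\lambda|=1$, and the Kodaira dimension $\kappa(X)$ is $0$ if $\lambda$ is a root of unity and $-\infty$ otherwise. Here $\kappa(X)=-\infty$ if all plurigenera $P_m=\dim H^0(X,K_X^{\otimes m})$, $m\ge1$, vanish, and otherwise $\kappa(X)$ is the least integer $k\ge0$ such that the sequence $P_m/m^k$, $m\ge 1$, is bounded. -/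

import Mathlib

open scoped Manifold ContDiff Topology

noncomputable section

/-- The quotient of a manifold by a free and properly discontinuous action by `C^n` maps is a `C^n`
manifold. -/
theorem isManifold_quotient_of_contMDiff_vadd
    {𝕜 : Type*} [NontriviallyNormedField 𝕜] {E : Type*} [NormedAddCommGroup E] [NormedSpace 𝕜 E]
    {H : Type*} [TopologicalSpace H] (I : ModelWithCorners 𝕜 E H) (n : WithTop ℕ∞)
    (M : Type*) [TopologicalSpace M] [T2Space M] [LocallyCompactSpace M] [ChartedSpace H M]
    [IsManifold I n M] (G : Type*) [AddGroup G] [AddAction G M]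
    [ProperlyDiscontinuousVAdd G M] [ContinuousConstVAdd G M] [IsCancelVAdd G M]
    (hG : ∀ g : G, ContMDiff I I n (fun x : M => g +ᵥ x)) :
    IsManifold I n (AddAction.orbitRel.Quotient G M) := by
  have hq := (isAddQuotientCoveringMap_quotientMk_of_properlyDiscontinuousVAdd
    (G := G) (E := M))
  have hloc := hq.isCoveringMap.isLocalHomeomorph
  refine isManifold_of_contDiffOn I n _ ?_
  rintro e e' ⟨q₁, rfl⟩ ⟨q₂, rfl⟩
  generalize hp : (Quotient.mk_surjective (s := AddAction.orbitRel G M)).hasRightInverse.choose q₁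
    = p
  generalize hp' : (Quotient.mk_surjective (s := AddAction.orbitRel G M)).hasRightInverse.choose q₂
    = p'
  set e := (hloc.localInverseAt p).trans (chartAt H p) with he
  set e' := (hloc.localInverseAt p').trans (chartAt H p') with he'
  have key : ContMDiffOn I I n (e.symm ≫ₕ e') (e.symm ≫ₕ e').source := by
    intro y hy
    refine ContMDiffAt.contMDiffWithinAt ?_
    have hy1 : y ∈ (chartAt H p).target := by
      simp [he, he'] at hy; exact hy.1.1
    have hy2 : Quotient.mk _ ((chartAt H p).symm y) ∈ (hloc.localInverseAt p').source := by
      simp [he, he'] at hy; exact hy.2.1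
    have hy3 : hloc.localInverseAt p' (Quotient.mk _ ((chartAt H p).symm y)) ∈
        (chartAt H p').source := by
      simp [he, he'] at hy; exact hy.2.2
    set z := (chartAt H p).symm y with hz
    set e₂ := hloc.localInverseAt p' with he₂
    have hsymm : ∀ w, e₂.symm w = Quotient.mk _ w := fun w => by
      rw [he₂, hloc.localInverseAt_symm]
    obtain ⟨g, hg⟩ : ∃ g : G, g +ᵥ z = e₂ (Quotient.mk _ z) := by
      have : (Quotient.mk (AddAction.orbitRel G M) (e₂ (Quotient.mk _ z))) = Quotient.mk _ z := by
        rw [← hsymm, e₂.left_inv hy2]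
      exact hq.apply_eq_iff_mem_orbit.mp this
    have hev : ∀ᶠ w in 𝓝 z, e₂ (Quotient.mk _ w) = g +ᵥ w := by
      have h1 : ∀ᶠ w in 𝓝 z, g +ᵥ w ∈ e₂.target :=
        (continuous_const_vadd g).continuousAt.eventually_mem
          (e₂.open_target.mem_nhds (by rw [hg]; exact e₂.map_source hy2))
      filter_upwards [h1] with w hw
      have : Quotient.mk (AddAction.orbitRel G M) w = e₂.symm (g +ᵥ w) := by
        rw [hsymm]
        exact (hq.map_vadd g).symm
      rw [this, e₂.right_inv hw]
    have hcs : ContMDiffAt I I n (chartAt H p).symm y :=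
      contMDiffOn_chart_symm.contMDiffAt ((chartAt H p).open_target.mem_nhds hy1)
    have hc' : ContMDiffAt I I n (chartAt H p') (g +ᵥ z) :=
      contMDiffOn_chart.contMDiffAt ((chartAt H p').open_source.mem_nhds (by rw [hg]; exact hy3))
    have hcomp : ContMDiffAt I I n (fun v => chartAt H p' (g +ᵥ (chartAt H p).symm v)) y :=
      ContMDiffAt.comp (g := chartAt H p') (f := fun v => g +ᵥ (chartAt H p).symm v) y hc'
        (((hG g) z).comp y hcs)
    refine hcomp.congr_of_eventuallyEq ?_
    filter_upwards [hcs.continuousAt.eventually hev] with v hv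
    simp only [he, he', OpenPartialHomeomorph.coe_trans, Function.comp_apply,
      OpenPartialHomeomorph.trans_symm_eq_symm_trans_symm, hloc.localInverseAt_symm]
    rw [← hv]
  rw [← contMDiffOn_iff_contDiffOn]
  exact I.contMDiff.comp_contMDiffOn
    (key.comp (I.contMDiffOn_symm.mono Set.inter_subset_right) fun y hy => hy.1)

section Canonical

variable {E : Type*} [NormedAddCommGroup E] [NormedSpace ℂ E] [FiniteDimensional ℂ E]
  {H : Type*} [TopologicalSpace H] (I : ModelWithCorners ℂ E H)
  (X : Type*) [TopologicalSpace X] [ChartedSpace H X] [IsManifold I ω X]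

/-- The `m`-th tensor power `K_X^{⊗ m}` of the canonical bundle `K_X = Λ^d T^*X` of a complex
manifold `X` (without boundary, `d = dim E`), as the line bundle with transition functions
`det (D(φ_i ∘ φ_j⁻¹)) ^ m`: a local section is `g_i (dz₁ ∧ ⋯ ∧ dz_d)^{⊗ m}` in the coordinates `φ_i`,
and its coefficients are related by `g_j = det (D(φ_i ∘ φ_j⁻¹)) ^ m * g_i`. Here
`(tangentBundleCore I X).coordChange j i x` is the derivative of `φ_i ∘ φ_j⁻¹` at `φ_j x`.
The fibre at `x` is `ℂ`, the coefficient with respect to the preferred chart at `x`. -/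
def pluricanonicalCore (m : ℕ) : VectorBundleCore ℂ X ℂ (atlas H X) :=
  have : IsManifold I 1 X := IsManifold.of_le (n := ω) le_top
  { baseSet := fun i => i.1.source
    isOpen_baseSet := fun i => i.1.open_source
    indexAt := achart H
    mem_baseSet_at := mem_chart_source H
    coordChange := fun i j x =>
      (((tangentBundleCore I X).coordChange j i x).det ^ m) • ContinuousLinearMap.id ℂ ℂ
    coordChange_self := by
      intro i x hx v
      have : (tangentBundleCore I X).coordChange i i x = ContinuousLinearMap.id ℂ E := by
        ext v; exact (tangentBundleCore I X).coordChange_self i x hx v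
      have hd : (ContinuousLinearMap.id ℂ E).det = 1 := LinearMap.det_id
      rw [this, hd]
      simp
    continuousOn_coordChange := by
      intro i j
      have h := (tangentBundleCore I X).continuousOn_coordChange j i
      rw [Set.inter_comm] at h
      exact ((ContinuousLinearMap.continuous_det.comp_continuousOn h).pow m).smul
        continuousOn_const
    coordChange_comp := by
      intro i j k x hx v
      have : ((tangentBundleCore I X).coordChange j i x).comp
          ((tangentBundleCore I X).coordChange k j x) =
          (tangentBundleCore I X).coordChange k i x := by
        ext v
        exact (tangentBundleCore I X).coordChange_comp k j i x ⟨⟨hx.2, hx.1.2⟩, hx.1.1⟩ v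
      rw [← this]
      have hd : (((tangentBundleCore I X).coordChange j i x).comp
          ((tangentBundleCore I X).coordChange k j x)).det =
          ((tangentBundleCore I X).coordChange j i x).det *
          ((tangentBundleCore I X).coordChange k j x).det := LinearMap.det_comp _ _
      rw [hd]
      simp
      ring }

/-- The bundle `K_X^{⊗ m}` is holomorphic. -/
instance (m : ℕ) : (pluricanonicalCore I X m).IsContMDiff I ω where
  contMDiffOn_coordChange i j := by
    have : IsManifold I 1 X := IsManifold.of_le (n := ω) le_top
    have : IsManifold I (ω + 1) X := inferInstanceAs (IsManifold I ω X)
    have hdet : ContDiff ℂ ω (fun A : E →L[ℂ] E => A.det) := by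
      let b := Module.finBasis ℂ E
      have h : (fun A : E →L[ℂ] E => A.det) = fun A : E →L[ℂ] E =>
          ∑ τ : Equiv.Perm (Fin (Module.finrank ℂ E)), ((Equiv.Perm.sign τ : ℤ) : ℂ) *
            ∏ k, (LinearMap.toContinuousLinearMap (b.coord (τ k))) (A (b k)) := by
        funext A
        change LinearMap.det (A : E →ₗ[ℂ] E) = _
        rw [← LinearMap.det_toMatrix b, Matrix.det_apply]
        simp [LinearMap.toMatrix_apply, Units.smul_def]
      rw [h]
      refine ContDiff.sum fun τ _ => contDiff_const.mul (contDiff_prod fun k _ => ?_)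
      fun_prop
    have := tangentBundleCore.isContMDiff (I := I) (M := X) (n := ω)
    have h := ((tangentBundleCore I X).contMDiffOn_coordChange (n := ω) I j i)
    rw [Set.inter_comm] at h
    exact (((hdet.pow m).smul contDiff_const).contMDiff).comp_contMDiffOn h

/-- The space `H⁰(X, K_X^{⊗ m})` of global holomorphic sections. For `m = 1` these are the
holomorphic forms of top degree. -/
abbrev PluricanonicalSection (m : ℕ) : Type _ :=
  ContMDiffSection I ℂ ω (pluricanonicalCore I X m).Fiber

/-- The Kodaira dimension: `-∞` (that is, `⊥`) if all the plurigenera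
`P_m = dim H⁰(X, K_X^{⊗ m})`, `m ≥ 1`, vanish, and otherwise the least `k` such that
`P_m / m ^ k`, `m ≥ 1`, is bounded (it is at most `dim X` when `X` is compact; the value is `⊤` if
there is no such `k`). -/
def kodairaDimension : WithBot ℕ∞ :=
  open Classical in
  if ∀ m : ℕ, 1 ≤ m → Subsingleton (PluricanonicalSection I X m) then ⊥
  else ((⨅ k ∈ {k : ℕ | ∃ C : ℕ, ∀ m : ℕ, 1 ≤ m →
    Module.rank ℂ (PluricanonicalSection I X m) ≤ ((C * m ^ k : ℕ) : Cardinal)}, (k : ℕ∞) : ℕ∞) :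
      WithBot ℕ∞)

variable {I X} in
/-- The pullback `f^* s` of a section `s` of `K_X` by a holomorphic map `f : X → X`. If
`s = g dw₁ ∧ ⋯ ∧ dw_d` in the preferred chart at `f x`, then `f^* s = det (Df) * (g ∘ f) dz₁ ∧ ⋯ ∧ dz_d`
in the preferred chart at `x`; these two charts are the ones that identify the tangent spaces at `x`
and `f x` with `E` and the fibres of `K_X` at `x` and `f x` with `ℂ`. -/
def canonicalPullback (f : X → X) (s : PluricanonicalSection I X 1) (x : X) :
    (pluricanonicalCore I X 1).Fiber x :=
  let D : E →L[ℂ] E := mfderiv I I f x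
  let c : ℂ := s (f x)
  D.det * c

end Canonical

section TwistedQuotient

variable {E : Type*} [NormedAddCommGroup E] [NormedSpace ℂ E]
  {M : Type*} [TopologicalSpace M] [ChartedSpace E M]
  {V : Type*} [NormedAddCommGroup V] [NormedSpace ℂ V]
  {Γ : Submodule ℤ V} {ι : Type*} [Fintype ι]

/-- The degree `deg (∑ aᵢ γᵢ) = ∑ aᵢ` of a lattice vector with respect to a basis `(γᵢ)` of the
lattice. -/
def latticeDegree (b : Module.Basis ι ℤ Γ) : Γ →ₗ[ℤ] ℤ := ∑ i, b.coord i

/-- The product `M × V`, as a type that remembers the automorphism `f` of `M` and the basis `b` of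
the lattice `Γ` of `V`, so that it can carry the twisted action of `Γ`. -/
def TwistedProduct (_f : M ≃ₘ^ω⟮𝓘(ℂ, E), 𝓘(ℂ, E)⟯ M) (_b : Module.Basis ι ℤ Γ) : Type _ := M × V

variable (f : M ≃ₘ^ω⟮𝓘(ℂ, E), 𝓘(ℂ, E)⟯ M) (b : Module.Basis ι ℤ Γ)

namespace TwistedProduct

instance : TopologicalSpace (TwistedProduct f b) := inferInstanceAs (TopologicalSpace (M × V))

instance : ChartedSpace (ModelProd E V) (TwistedProduct f b) :=
  inferInstanceAs (ChartedSpace (ModelProd E V) (M × V))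

instance [IsManifold 𝓘(ℂ, E) ω M] :
    IsManifold (𝓘(ℂ, E).prod 𝓘(ℂ, V)) ω (TwistedProduct f b) :=
  inferInstanceAs (IsManifold (𝓘(ℂ, E).prod 𝓘(ℂ, V)) ω (M × V))

instance [T2Space M] : T2Space (TwistedProduct f b) := inferInstanceAs (T2Space (M × V))

instance [LocallyCompactSpace M] [FiniteDimensional ℂ V] :
    LocallyCompactSpace (TwistedProduct f b) :=
  have : ProperSpace V := FiniteDimensional.proper ℂ V
  inferInstanceAs (LocallyCompactSpace (M × V))

/-- The action `γ · (z, t) = (f ^ deg γ (z), t + γ)` of the lattice `Γ` on `M × V`: every element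
of the basis of `Γ` acts on `M` by `f`, and `Γ` acts on `V` by translations. -/
instance : AddAction Γ (TwistedProduct f b) where
  vadd γ p := (((f.toHomeomorph ^ latticeDegree b γ : M ≃ₜ M) p.1, p.2 + (γ : V)) : M × V)
  zero_vadd p := by
    change (((f.toHomeomorph ^ latticeDegree b 0 : M ≃ₜ M) p.1, p.2 + ((0 : Γ) : V)) : M × V) = p
    simp
    rfl
  add_vadd γ γ' p := by
    change (((f.toHomeomorph ^ latticeDegree b (γ + γ') : M ≃ₜ M) p.1,
      p.2 + ((γ + γ' : Γ) : V)) : M × V) =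
      ((f.toHomeomorph ^ latticeDegree b γ : M ≃ₜ M)
        ((f.toHomeomorph ^ latticeDegree b γ' : M ≃ₜ M) p.1), p.2 + (γ' : V) + (γ : V))
    rw [map_add, zpow_add]
    refine Prod.ext rfl ?_
    push_cast
    abel

theorem contMDiff_zpow (k : ℤ) :
    ContMDiff 𝓘(ℂ, E) 𝓘(ℂ, E) ω ((f.toHomeomorph ^ k : M ≃ₜ M) : M → M) := by
  have hnat : ∀ (g : M ≃ₜ M), ContMDiff 𝓘(ℂ, E) 𝓘(ℂ, E) ω (g : M → M) → ∀ n : ℕ,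
      ContMDiff 𝓘(ℂ, E) 𝓘(ℂ, E) ω ((g ^ n : M ≃ₜ M) : M → M) := by
    intro g hg n
    induction n with
    | zero => exact contMDiff_id
    | succ n ih => rw [pow_succ]; exact ih.comp hg
  cases k with
  | ofNat n => simpa using hnat f.toHomeomorph f.contMDiff n
  | negSucc n =>
    rw [zpow_negSucc, ← inv_pow]
    exact hnat f.toHomeomorph⁻¹ f.symm.contMDiff (n + 1)

theorem contMDiff_vadd (γ : Γ) :
    ContMDiff (𝓘(ℂ, E).prod 𝓘(ℂ, V)) (𝓘(ℂ, E).prod 𝓘(ℂ, V)) ω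
      (fun p : TwistedProduct f b => γ +ᵥ p) := by
  have h : ContMDiff 𝓘(ℂ, V) 𝓘(ℂ, V) ω (fun t : V => t + (γ : V)) :=
    (contDiff_id.add contDiff_const).contMDiff
  exact (contMDiff_zpow f (latticeDegree b γ)).prodMap h

instance : ContinuousConstVAdd Γ (TwistedProduct f b) where
  continuous_const_vadd γ := (contMDiff_vadd f b γ).continuous

instance : IsCancelVAdd Γ (TwistedProduct f b) where
  left_cancel' γ p q h := by simpa using h
  right_cancel' γ γ' p h := by
    have h2 : p.2 + (γ : V) = p.2 + (γ' : V) := congrArg Prod.snd h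
    exact Subtype.ext (add_left_cancel h2)

instance [DiscreteTopology Γ] [FiniteDimensional ℂ V] :
    ProperlyDiscontinuousVAdd Γ (TwistedProduct f b) where
  finite_disjoint_inter_image {K L} hK hL := by
    have : ProperSpace V := FiniteDimensional.proper ℂ V
    have : DiscreteTopology Γ.toAddSubgroup := inferInstanceAs (DiscreteTopology Γ)
    have hs : Continuous (fun p : TwistedProduct f b => p.2) := continuous_snd
    have hc : IsCompact ((fun x : V × V => x.1 - x.2) ''
        (((fun p : TwistedProduct f b => p.2) '' L) ×ˢ
          ((fun p : TwistedProduct f b => p.2) '' K))) :=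
      ((hL.image hs).prod (hK.image hs)).image (by fun_prop)
    have hfin := Metric.finite_isBounded_inter_isClosed (K := (_ : Set V))
      (s := (Γ.toAddSubgroup : Set V)) DiscreteTopology.isDiscrete hc.isBounded
      (AddSubgroup.isClosed_of_discrete (H := Γ.toAddSubgroup))
    refine (hfin.preimage (f := fun γ : Γ => (γ : V)) Subtype.val_injective.injOn).subset ?_
    rintro γ ⟨_, ⟨p, hp, rfl⟩, hl⟩
    refine ⟨⟨((γ +ᵥ p).2, p.2), ⟨⟨_, hl, rfl⟩, ⟨p, hp, rfl⟩⟩, ?_⟩, γ.2⟩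
    change p.2 + (γ : V) - p.2 = γ
    abel

end TwistedProduct

/-- The quotient `X = (M × V) / Γ`, with the complex structure for which the charts are the local
inverses of `M × V → X` followed by charts of `M × V`. -/
abbrev TwistedQuotient : Type _ := AddAction.orbitRel.Quotient Γ (TwistedProduct f b)

instance [T2Space M] [LocallyCompactSpace M] [IsManifold 𝓘(ℂ, E) ω M] [DiscreteTopology Γ]
    [FiniteDimensional ℂ V] :
    IsManifold (𝓘(ℂ, E).prod 𝓘(ℂ, V)) ω (TwistedQuotient f b) :=
  isManifold_quotient_of_contMDiff_vadd _ _ _ _ (TwistedProduct.contMDiff_vadd f b)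

end TwistedQuotient

end

/-! The ratio `f^*σ / σ` is a holomorphic function on a compact connected manifold, hence a constant
`λ` (`existsUnique_jacobianDet_mul_eq`). The total mass of `σ ∧ \bar σ` is finite, positive and
unchanged by the bijection `f`, while pulling back scales it by `|λ|²`; so `|λ| = 1`
(`norm_eq_one_of_jacobianDet_mul_eq`).

A section of `K_X^{⊗ m}` pulls back to a `Γ`-invariant section on `M × V`. Divide it by `(σ ∧ dt₁ ∧
⋯ ∧ dt_p)^{⊗ m}`: the quotient `h` is holomorphic and satisfies `h(γ · q) λ^{m deg γ} = h(q)`. Since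
`|λ| = 1`, `|h|` is invariant. As `M` is compact, `h` depends on `V` alone, where its norm is
`Γ`-periodic, hence bounded, and Liouville makes it a constant `C` (`exists_pullback_eq_const_mul`).
A vector of degree `1` gives `C λ^m = C`, so `C = 0` unless `λ^m = 1`; if `λ^m = 1`, the reference
form is invariant and descends (`exists_pullback_quotientMk_eq`). Thus `P_m` is `1` or `0` according
to whether `λ^m = 1`.

Sections are handled as functions `s : X → ℂ` of coefficients in the preferred chart at each point.
Such an `s` need not be continuous; regularity is a property of `pluricanonicalCoeff` in a fixed
chart. -/

/-! ### Coefficients of pluricanonical sections, and their pullbacks. -/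

section PluricanonicalCoefficients

open Bundle

variable {E : Type*} [NormedAddCommGroup E] [NormedSpace ℂ E]
  {H : Type*} [TopologicalSpace H] (I : ModelWithCorners ℂ E H)
  {X : Type*} [TopologicalSpace X] [ChartedSpace H X] [IsManifold I ω X]

/-- The derivative of `ψ` at `y` in the preferred charts at `y` and `ψ y`. -/
noncomputable def chartDeriv {Y : Type*} [TopologicalSpace Y] [ChartedSpace H Y]
    (ψ : Y → X) (y : Y) : E →L[ℂ] E :=
  mfderiv I I ψ y

/-- The determinant of the derivative of `ψ` at `y` in the preferred charts at `y` and `ψ y`. -/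
noncomputable def jacobianDet {Y : Type*} [TopologicalSpace Y] [ChartedSpace H Y]
    (ψ : Y → X) (y : Y) : ℂ :=
  (chartDeriv I ψ y).det

theorem ContinuousLinearMap.det_comp {𝕜 F : Type*} [NontriviallyNormedField 𝕜]
    [NormedAddCommGroup F] [NormedSpace 𝕜 F] (A B : F →L[𝕜] F) :
    (A.comp B).det = A.det * B.det :=
  LinearMap.det_comp _ _

theorem ContinuousLinearMap.det_id {𝕜 F : Type*} [NontriviallyNormedField 𝕜]
    [NormedAddCommGroup F] [NormedSpace 𝕜 F] : (ContinuousLinearMap.id 𝕜 F).det = 1 :=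
  LinearMap.det_id

theorem det_tangentCoordChange_comp {w x y z : X}
    (hw : z ∈ (chartAt H w).source) (hx : z ∈ (chartAt H x).source)
    (hy : z ∈ (chartAt H y).source) :
    (tangentCoordChange I x y z).det * (tangentCoordChange I w x z).det =
      (tangentCoordChange I w y z).det := by
  rw [← ContinuousLinearMap.det_comp]
  congr 1
  ext v
  exact tangentCoordChange_comp (by simp [hw, hx, hy])

theorem det_tangentCoordChange_self {x z : X} (hx : z ∈ (chartAt H x).source) :
    (tangentCoordChange I x x z).det = 1 := by
  rw [← ContinuousLinearMap.det_id (𝕜 := ℂ) (F := E)]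
  congr 1
  ext v
  exact tangentCoordChange_self (by simp [hx])

theorem det_tangentCoordChange_ne_zero {x y z : X} (hx : z ∈ (chartAt H x).source)
    (hy : z ∈ (chartAt H y).source) : (tangentCoordChange I x y z).det ≠ 0 := by
  have h := det_tangentCoordChange_comp I hx hy hx
  rw [det_tangentCoordChange_self I hx] at h
  exact right_ne_zero_of_mul_eq_one h

/-- The coefficient, in the preferred chart at `x₀`, of the section of `K_X^{⊗ m}` whose coefficient
at each `x` in the preferred chart at `x` is `s x`. -/
noncomputable def pluricanonicalCoeff (m : ℕ) (s : X → ℂ) (x₀ x : X) : ℂ :=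
  (tangentCoordChange I x₀ x x).det ^ m * s x

theorem pluricanonicalCoeff_ne_zero_iff {m : ℕ} {s : X → ℂ} {x₀ x : X}
    (hx : x ∈ (chartAt H x₀).source) : pluricanonicalCoeff I m s x₀ x ≠ 0 ↔ s x ≠ 0 := by
  have := pow_ne_zero m (det_tangentCoordChange_ne_zero I hx (mem_chart_source H x))
  rw [pluricanonicalCoeff, mul_ne_zero_iff_left this]

theorem pluricanonicalCoeff_changeChart {m : ℕ} {s : X → ℂ} {x₀ x₁ x : X}
    (h₀ : x ∈ (chartAt H x₀).source) (h₁ : x ∈ (chartAt H x₁).source) :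
    pluricanonicalCoeff I m s x₀ x =
      (tangentCoordChange I x₀ x₁ x).det ^ m * pluricanonicalCoeff I m s x₁ x := by
  rw [pluricanonicalCoeff, pluricanonicalCoeff,
    ← det_tangentCoordChange_comp I h₀ h₁ (mem_chart_source H x)]
  ring

/-- A family of coefficients `s x`, with respect to the preferred charts at `x`, defines a section of
`K_X^{⊗ m}` that is holomorphic at `x₀`. -/
def IsHolomorphicPluricanonicalAt (m : ℕ) (s : X → ℂ) (x₀ : X) : Prop :=
  ContMDiffAt I 𝓘(ℂ, ℂ) ω (pluricanonicalCoeff I m s x₀) x₀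

theorem IsHolomorphicPluricanonicalAt.congr {m : ℕ} {s t : X → ℂ} {x₀ : X}
    (hs : IsHolomorphicPluricanonicalAt I m s x₀) (h : t =ᶠ[𝓝 x₀] s) :
    IsHolomorphicPluricanonicalAt I m t x₀ := by
  refine ContMDiffAt.congr_of_eventuallyEq hs ?_
  filter_upwards [h] with x hx
  simp [pluricanonicalCoeff, hx]

theorem IsHolomorphicPluricanonicalAt.pow {m : ℕ} {s : X → ℂ} {x₀ : X}
    (hs : IsHolomorphicPluricanonicalAt I m s x₀) (k : ℕ) :
    IsHolomorphicPluricanonicalAt I (m * k) (fun x => s x ^ k) x₀ := by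
  refine (ContMDiffAt.pow hs k).congr_of_eventuallyEq (.of_eq ?_)
  funext x
  simp [pluricanonicalCoeff, mul_pow, pow_mul]

/-- The quotient of two holomorphic sections is a holomorphic function where the denominator does
not vanish. -/
theorem IsHolomorphicPluricanonicalAt.div {m : ℕ} {s t : X → ℂ} {x₀ : X}
    (hs : IsHolomorphicPluricanonicalAt I m s x₀) (ht : IsHolomorphicPluricanonicalAt I m t x₀)
    (h₀ : t x₀ ≠ 0) : ContMDiffAt I 𝓘(ℂ, ℂ) ω (fun x => s x / t x) x₀ := by
  have h₁ := ContMDiffAt.div₀ hs ht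
    ((pluricanonicalCoeff_ne_zero_iff I (mem_chart_source H x₀)).2 h₀)
  refine h₁.congr_of_eventuallyEq ?_
  filter_upwards [(chartAt H x₀).open_source.mem_nhds (mem_chart_source H x₀)] with x hx
  have := det_tangentCoordChange_ne_zero I hx (mem_chart_source H x)
  simp only [pluricanonicalCoeff, Pi.div_apply]
  rw [mul_div_mul_left _ _ (pow_ne_zero m this)]

/-- The hypothesis controls the chart at `x` only at `x` itself; the transition determinant carries
this to the fixed chart at `x₀`. Continuity suffices for the bounds on compact sets below. -/
theorem continuousOn_pluricanonicalCoeff [FiniteDimensional ℂ E] {m : ℕ} {s : X → ℂ}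
    (hs : ∀ x, IsHolomorphicPluricanonicalAt I m s x) (x₀ : X) :
    ContinuousOn (pluricanonicalCoeff I m s x₀) (chartAt H x₀).source := by
  intro x hx
  have h₁ := (ContinuousLinearMap.continuous_det.comp_continuousOn
    (continuousOn_tangentCoordChange (I := I) x₀ x)).pow m
  simp only [extChartAt_source] at h₁
  have hU : (chartAt H x₀).source ∩ (chartAt H x).source ∈ 𝓝 x :=
    ((chartAt H x₀).open_source.inter (chartAt H x).open_source).mem_nhds
      ⟨hx, mem_chart_source H x⟩
  refine (((h₁.continuousAt hU).mul (hs x).continuousAt).congr ?_).continuousWithinAt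
  filter_upwards [hU] with y hy
  exact (pluricanonicalCoeff_changeChart I hy.1 hy.2).symm

theorem contDiff_det [FiniteDimensional ℂ E] : ContDiff ℂ ω (fun A : E →L[ℂ] E => A.det) := by
  let b := Module.finBasis ℂ E
  have h : (fun A : E →L[ℂ] E => A.det) = fun A : E →L[ℂ] E =>
      ∑ τ : Equiv.Perm (Fin (Module.finrank ℂ E)), ((Equiv.Perm.sign τ : ℤ) : ℂ) *
        ∏ k, (LinearMap.toContinuousLinearMap (b.coord (τ k))) (A (b k)) := by
    funext A
    change LinearMap.det (A : E →ₗ[ℂ] E) = _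
    rw [← LinearMap.det_toMatrix b, Matrix.det_apply]
    simp [LinearMap.toMatrix_apply, Units.smul_def]
  rw [h]
  refine ContDiff.sum fun τ _ => contDiff_const.mul (contDiff_prod fun k _ => ?_)
  fun_prop

section Pullback

variable {Y : Type*} [TopologicalSpace Y] [ChartedSpace H Y] [IsManifold I ω Y]

/-- The coefficient of a pullback in arbitrary charts. -/
theorem pluricanonicalCoeff_pullback (m : ℕ) (s : X → ℂ) (ψ : Y → X) {x₀ : X} {y₀ y : Y}
    (hx : ψ y ∈ (chartAt H x₀).source) :
    pluricanonicalCoeff I m (fun y => jacobianDet I ψ y ^ m * s (ψ y)) y₀ y =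
      ((tangentCoordChange I (ψ y) x₀ (ψ y)).det * jacobianDet I ψ y *
        (tangentCoordChange I y₀ y y).det) ^ m * pluricanonicalCoeff I m s x₀ (ψ y) := by
  have h := det_tangentCoordChange_comp I (mem_chart_source H (ψ y)) hx (mem_chart_source H (ψ y))
  rw [det_tangentCoordChange_self I (mem_chart_source H (ψ y))] at h
  have h' := congrArg (· ^ m) h
  simp only [mul_pow, one_pow] at h'
  simp only [pluricanonicalCoeff, mul_pow]
  linear_combination (-(tangentCoordChange I y₀ y y).det ^ m * jacobianDet I ψ y ^ m *
    s (ψ y)) * h'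

/-- `jacobianDet` uses charts that move with the point. The derivative is regular in the fixed
charts of `inTangentCoordinates`, and the chart-change determinants are exactly those of
`pluricanonicalCoeff_pullback`. -/
theorem IsHolomorphicPluricanonicalAt.pullback [FiniteDimensional ℂ E] {m : ℕ} {s : X → ℂ}
    {ψ : Y → X} {y₀ : Y} (hs : IsHolomorphicPluricanonicalAt I m s (ψ y₀))
    (hψ : ContMDiffAt I I ω ψ y₀) :
    IsHolomorphicPluricanonicalAt I m (fun y => jacobianDet I ψ y ^ m * s (ψ y)) y₀ := by
  -- Differentiation costs nothing here, because `ω + 1 = ω`.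
  have h₀ : ContMDiffAt I 𝓘(ℂ, E →L[ℂ] E) ω
      (inTangentCoordinates I I id ψ (chartDeriv I ψ) y₀) y₀ := hψ.mfderiv_const le_rfl
  have h₁ := (contDiff_det (E := E)).contMDiff.contMDiffAt.comp y₀ h₀
  refine ((h₁.pow m).mul (hs.comp y₀ hψ)).congr_of_eventuallyEq ?_
  filter_upwards [(chartAt H y₀).open_source.mem_nhds (mem_chart_source H y₀),
    hψ.continuousAt.eventually ((chartAt H (ψ y₀)).open_source.mem_nhds (mem_chart_source H _))]
    with y hy hψy
  rw [pluricanonicalCoeff_pullback I m s ψ hψy]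
  simp only [Pi.mul_apply, Function.comp_apply]
  rw [inTangentCoordinates_eq _ _ _ hy hψy, ContinuousLinearMap.det_comp,
    ContinuousLinearMap.det_comp, ← mul_assoc]
  rfl

end Pullback

/-- The trivialization at `x₀` multiplies the fibre coordinate by the transition function, which
unfolds to `pluricanonicalCoeff`. -/
theorem pluricanonicalSection_contMDiffAt_iff [FiniteDimensional ℂ E] {m : ℕ}
    {s : ∀ x, (pluricanonicalCore I X m).Fiber x} {x₀ : X} :
    ContMDiffAt I (I.prod 𝓘(ℂ, ℂ)) ω (fun x => TotalSpace.mk' ℂ x (s x)) x₀ ↔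
      IsHolomorphicPluricanonicalAt I m s x₀ := by
  rw [contMDiffAt_section]
  rfl

section Jacobian

variable {X Y Z : Type*} [TopologicalSpace X] [ChartedSpace H X] [TopologicalSpace Y]
  [ChartedSpace H Y] [TopologicalSpace Z] [ChartedSpace H Z]

theorem jacobianDet_comp {ψ : Y → X} {χ : Z → Y} {z : Z}
    (hψ : ContMDiffAt I I ω ψ (χ z)) (hχ : ContMDiffAt I I ω χ z) :
    jacobianDet I (ψ ∘ χ) z = jacobianDet I ψ (χ z) * jacobianDet I χ z := by
  have h : chartDeriv I (ψ ∘ χ) z = (chartDeriv I ψ (χ z)).comp (chartDeriv I χ z) :=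
    mfderiv_comp z (hψ.mdifferentiableAt (by simp)) (hχ.mdifferentiableAt (by simp))
  rw [jacobianDet, h, ContinuousLinearMap.det_comp]
  rfl

theorem jacobianDet_id (x : X) : jacobianDet I (id : X → X) x = 1 := by
  have h : chartDeriv I (id : X → X) x = ContinuousLinearMap.id ℂ E := mfderiv_id
  rw [jacobianDet, h, ContinuousLinearMap.det_id]

theorem jacobianDet_congr {ψ χ : Y → X} {y : Y} (h : ψ =ᶠ[𝓝 y] χ) :
    jacobianDet I ψ y = jacobianDet I χ y := by
  have h : chartDeriv I ψ y = chartDeriv I χ y := h.mfderiv_eq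
  rw [jacobianDet, h, jacobianDet]

end Jacobian

end PluricanonicalCoefficients

/-! ### The multiplier has absolute value one, by integration of `σ ∧ \bar σ`. -/

section FormVolume

open MeasureTheory
open scoped ENNReal

variable {E : Type*} [NormedAddCommGroup E] [NormedSpace ℂ E]

/-- The real determinant is the norm from `ℂ` to `ℝ` of the complex one. This is why `formVolume`
integrates a squared modulus. -/
theorem ContinuousLinearMap.abs_det_restrictScalars [FiniteDimensional ℂ E] (A : E →L[ℂ] E) :
    ENNReal.ofReal |(A.restrictScalars ℝ).det| = ‖A.det‖ₑ ^ 2 := by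
  have h : (A.restrictScalars ℝ).det = ‖A.det‖ ^ 2 := by
    rw [← Complex.normSq_eq_norm_sq, ← Algebra.norm_complex_apply]
    exact LinearMap.det_restrictScalars (f := (A : E →ₗ[ℂ] E))
  rw [h, abs_of_nonneg (by positivity), ENNReal.ofReal_pow (norm_nonneg _), ofReal_norm]

variable {M : Type*} [TopologicalSpace M] [ChartedSpace E M] [IsManifold 𝓘(ℂ, E) ω M]

/-- The derivative in charts of a holomorphic map. -/
theorem hasFDerivAt_chartAt_comp {ψ : M → M} {x x₀ x₁ : M}
    (hψ : ContMDiffAt 𝓘(ℂ, E) 𝓘(ℂ, E) ω ψ x)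
    (hx₀ : x ∈ (chartAt E x₀).source) (hx₁ : ψ x ∈ (chartAt E x₁).source) :
    HasFDerivAt (chartAt E x₁ ∘ ψ ∘ (chartAt E x₀).symm)
      ((tangentCoordChange 𝓘(ℂ, E) (ψ x) x₁ (ψ x)).comp
        ((chartDeriv 𝓘(ℂ, E) ψ x).comp (tangentCoordChange 𝓘(ℂ, E) x₀ x x)))
      (chartAt E x₀ x) := by
  -- Factor through the preferred charts at `x` and `ψ x`, in which `mfderiv` is the ordinary
  -- derivative.
  have h₁ := hasFDerivWithinAt_tangentCoordChange (I := 𝓘(ℂ, E)) (x := x₀) (y := x) (z := x)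
    (by simp [hx₀])
  have h₂ := ((hψ.mdifferentiableAt (by simp)).hasMFDerivAt).2
  have h₃ := hasFDerivWithinAt_tangentCoordChange (I := 𝓘(ℂ, E)) (x := ψ x) (y := x₁) (z := ψ x)
    (by simp [hx₁])
  simp only [mfld_simps, hasFDerivWithinAt_univ] at h₁ h₂ h₃
  have h₂' : HasFDerivAt (chartAt E (ψ x) ∘ ψ ∘ (chartAt E x).symm) (chartDeriv 𝓘(ℂ, E) ψ x)
      (chartAt E x x) := hasFDerivWithinAt_univ.1 h₂
  have e₁ : (chartAt E x ∘ (chartAt E x₀).symm) (chartAt E x₀ x) = chartAt E x x := by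
    simp [hx₀]
  have e₂ : (chartAt E (ψ x) ∘ ψ ∘ (chartAt E x).symm) (chartAt E x x) = chartAt E (ψ x) (ψ x) := by
    simp
  rw [← e₁] at h₂'
  have h₄ := h₂'.comp _ h₁
  rw [← e₂, ← e₁] at h₃
  refine (HasFDerivAt.comp (chartAt E x₀ x) (g := chartAt E x₁ ∘ (chartAt E (ψ x)).symm) h₃ h₄).congr_of_eventuallyEq ?_
  have hsymm : Filter.Tendsto (chartAt E x₀).symm (𝓝 (chartAt E x₀ x)) (𝓝 x) := by
    have := (chartAt E x₀).continuousAt_symm ((chartAt E x₀).map_source hx₀)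
    rwa [ContinuousAt, (chartAt E x₀).left_inv hx₀] at this
  filter_upwards [hsymm.eventually ((chartAt E x).open_source.mem_nhds (mem_chart_source E x)),
    hsymm.eventually (hψ.continuousAt.eventually
      ((chartAt E (ψ x)).open_source.mem_nhds (mem_chart_source E (ψ x))))] with w hw hw'
  simp only [Function.comp_apply]
  rw [(chartAt E x).left_inv hw, (chartAt E (ψ x)).left_inv hw']

variable [FiniteDimensional ℂ E] [MeasurableSpace E] [BorelSpace E]

variable (E) in
/-- The integral of `i^{d²} s ∧ \bar s` over a subset of the domain of the preferred chart at `x₀`,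
up to a constant factor. -/
noncomputable def formVolume (s : M → ℂ) (x₀ : M) (A : Set M) : ℝ≥0∞ :=
  haveI : ProperSpace E := FiniteDimensional.proper ℂ E
  ∫⁻ w in chartAt E x₀ '' A,
    ‖pluricanonicalCoeff 𝓘(ℂ, E) 1 s x₀ ((chartAt E x₀).symm w)‖ₑ ^ 2 ∂(Measure.addHaar : Measure E)

variable [MeasurableSpace M] [BorelSpace M]

theorem OpenPartialHomeomorph.measurableSet_image {X Y : Type*} [TopologicalSpace X]
    [TopologicalSpace Y] [MeasurableSpace X] [BorelSpace X] [MeasurableSpace Y] [BorelSpace Y]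
    (e : OpenPartialHomeomorph X Y) {A : Set X} (hA : MeasurableSet A) (h : A ⊆ e.source) :
    MeasurableSet (e '' A) := by
  have h₁ : e '' A = Subtype.val '' ((fun y : e.target => e.symm y) ⁻¹' A) := by
    ext y
    constructor
    · rintro ⟨x, hx, rfl⟩
      exact ⟨⟨e x, e.map_source (h hx)⟩, by simpa [e.left_inv (h hx)] using hx, rfl⟩
    · rintro ⟨⟨y, hy⟩, hx, rfl⟩
      exact ⟨e.symm y, hx, e.right_inv hy⟩
  rw [h₁]
  refine e.open_target.measurableSet.subtype_image (Continuous.measurable ?_ hA)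
  exact continuousOn_iff_continuous_domRestrict.1 e.continuousOn_symm

/-- Change of variables: the real Jacobian is the squared modulus of the complex one, so it combines
with the squared coefficient into that of the pullback. -/
theorem formVolume_image {s : M → ℂ} {ψ : M → M} {lam : ℂ} {x₀ x₁ : M} {A : Set M}
    (hA : MeasurableSet A) (hψ : ContMDiff 𝓘(ℂ, E) 𝓘(ℂ, E) ω ψ) (hinj : ψ.Injective)
    (h₀ : A ⊆ (chartAt E x₀).source) (h₁ : ψ '' A ⊆ (chartAt E x₁).source)
    (hs : ∀ x ∈ A, jacobianDet 𝓘(ℂ, E) ψ x * s (ψ x) = lam * s x) :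
    formVolume E s x₁ (ψ '' A) = ‖lam‖ₑ ^ 2 * formVolume E s x₀ A := by
  have : ProperSpace E := FiniteDimensional.proper ℂ E
  have : FiniteDimensional ℝ E := FiniteDimensional.complexToReal E
  set g : E → E := chartAt E x₁ ∘ ψ ∘ (chartAt E x₀).symm with hg
  have himg : chartAt E x₁ '' (ψ '' A) = g '' (chartAt E x₀ '' A) := by
    simp only [Set.image_image, hg, Function.comp_apply]
    refine Set.image_congr fun x hx => ?_
    rw [(chartAt E x₀).left_inv (h₀ hx)]
  have hm := (chartAt E x₀).measurableSet_image hA h₀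
  set g' : E → E →L[ℂ] E := fun w =>
    let x := (chartAt E x₀).symm w
    (tangentCoordChange 𝓘(ℂ, E) (ψ x) x₁ (ψ x)).comp
        ((chartDeriv 𝓘(ℂ, E) ψ x).comp (tangentCoordChange 𝓘(ℂ, E) x₀ x x)) with hg'
  have hd : ∀ w ∈ chartAt E x₀ '' A,
      HasFDerivWithinAt g ((g' w).restrictScalars ℝ) (chartAt E x₀ '' A) w := by
    rintro _ ⟨x, hx, rfl⟩
    have := hasFDerivAt_chartAt_comp (hψ x) (h₀ hx) (h₁ (Set.mem_image_of_mem _ hx))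
    simp only [hg', (chartAt E x₀).left_inv (h₀ hx)]
    exact (this.restrictScalars ℝ).hasFDerivWithinAt
  have hgi : Set.InjOn g (chartAt E x₀ '' A) := by
    rintro _ ⟨x, hx, rfl⟩ _ ⟨y, hy, rfl⟩ hxy
    simp only [hg, Function.comp_apply, (chartAt E x₀).left_inv (h₀ hx),
      (chartAt E x₀).left_inv (h₀ hy)] at hxy
    rw [hinj ((chartAt E x₁).injOn (h₁ (Set.mem_image_of_mem _ hx))
      (h₁ (Set.mem_image_of_mem _ hy)) hxy)]
  rw [formVolume, formVolume, himg,
    lintegral_image_eq_lintegral_abs_det_fderiv_mul _ hm hd hgi, ← lintegral_const_mul' _ _ (by simp)]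
  refine setLIntegral_congr_fun hm ?_
  rintro _ ⟨x, hx, rfl⟩
  have hx₁ := h₁ (Set.mem_image_of_mem _ hx)
  simp only [ContinuousLinearMap.abs_det_restrictScalars, hg, hg', Function.comp_apply,
    (chartAt E x₀).left_inv (h₀ hx), (chartAt E x₁).left_inv hx₁]
  rw [← mul_pow, ← mul_pow, ← enorm_mul, ← enorm_mul]
  congr 2
  have h₂ := pluricanonicalCoeff_pullback 𝓘(ℂ, E) 1 s ψ (y₀ := x₀) hx₁
  rw [ContinuousLinearMap.det_comp, ContinuousLinearMap.det_comp, ← mul_assoc]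
  rw [pow_one] at h₂
  rw [jacobianDet] at h₂
  rw [← h₂]
  simp only [pluricanonicalCoeff, pow_one, hs x hx]
  ring

theorem formVolume_iUnion {s : M → ℂ} {x₀ : M} {ι : Type*} [Fintype ι] {A : ι → Set M}
    (hA : ∀ i, MeasurableSet (A i)) (hd : Pairwise (Function.onFun Disjoint A))
    (h₀ : ∀ i, A i ⊆ (chartAt E x₀).source) :
    formVolume E s x₀ (⋃ i, A i) = ∑ i, formVolume E s x₀ (A i) := by
  simp only [formVolume]
  rw [Set.image_iUnion, lintegral_iUnion (fun i => (chartAt E x₀).measurableSet_image (hA i) (h₀ i)),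
    tsum_fintype]
  intro i j hij
  refine Set.disjoint_left.2 ?_
  rintro _ ⟨x, hx, rfl⟩ ⟨y, hy, hxy⟩
  rw [(chartAt E x₀).injOn (h₀ j hy) (h₀ i hx) hxy] at hy
  exact Set.disjoint_left.1 (hd hij) hx hy

omit [MeasurableSpace M] [BorelSpace M] in
theorem formVolume_mono {s : M → ℂ} {x₀ : M} {A B : Set M} (h : A ⊆ B) :
    formVolume E s x₀ A ≤ formVolume E s x₀ B :=
  lintegral_mono_set (Set.image_mono h)

section

variable {s : M → ℂ} (hs : ∀ x, IsHolomorphicPluricanonicalAt 𝓘(ℂ, E) 1 s x) {x₀ : M} {K : Set M}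
  (hK : IsCompact K) (h₀ : K ⊆ (chartAt E x₀).source)

include hs hK h₀

omit [MeasurableSpace M] [BorelSpace M] in
theorem formVolume_lt_top_of_isCompact : formVolume E s x₀ K < ⊤ := by
  have : ProperSpace E := FiniteDimensional.proper ℂ E
  have hKc : IsCompact (chartAt E x₀ '' K) := hK.image_of_continuousOn
    ((chartAt E x₀).continuousOn.mono h₀)
  obtain ⟨C, hC⟩ := hK.exists_bound_of_continuousOn
    ((continuousOn_pluricanonicalCoeff 𝓘(ℂ, E) hs x₀).mono h₀)
  refine setLIntegral_lt_top_of_le_nnreal hKc.measure_lt_top.ne ⟨C.toNNReal ^ 2, ?_⟩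
  rintro _ ⟨x, hx, rfl⟩
  rw [(chartAt E x₀).left_inv (h₀ hx)]
  push_cast
  gcongr
  rw [← ofReal_norm]
  exact ENNReal.ofReal_le_ofReal (hC x hx)

omit [MeasurableSpace M] [BorelSpace M] in
theorem formVolume_pos_of_isCompact (hs₀ : ∀ x, s x ≠ 0) (hn : K ∈ 𝓝 x₀) :
    0 < formVolume E s x₀ K := by
  have : ProperSpace E := FiniteDimensional.proper ℂ E
  have hKc : IsCompact (chartAt E x₀ '' K) := hK.image_of_continuousOn
    ((chartAt E x₀).continuousOn.mono h₀)
  have hpos : 0 < (Measure.addHaar : Measure E) (chartAt E x₀ '' K) :=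
    Measure.measure_pos_of_mem_nhds _
      ((chartAt E x₀).image_mem_nhds (mem_chart_source E x₀) hn)
  obtain ⟨y, hy, hmin⟩ := hK.exists_isMinOn ⟨x₀, mem_of_mem_nhds hn⟩
    ((continuousOn_pluricanonicalCoeff 𝓘(ℂ, E) hs x₀).mono h₀).norm
  have hy₀ := (pluricanonicalCoeff_ne_zero_iff 𝓘(ℂ, E) (m := 1) (h₀ hy)).2 (hs₀ y)
  calc 0 < ‖pluricanonicalCoeff 𝓘(ℂ, E) 1 s x₀ y‖ₑ ^ 2 *
        (Measure.addHaar : Measure E) (chartAt E x₀ '' K) :=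
        ENNReal.mul_pos (by simpa using hy₀) hpos.ne'
    _ ≤ _ := by
      rw [formVolume, ← setLIntegral_const]
      refine setLIntegral_mono' hKc.measurableSet ?_
      rintro _ ⟨x, hx, rfl⟩
      rw [(chartAt E x₀).left_inv (h₀ hx)]
      gcongr 1
      rw [← ofReal_norm, ← ofReal_norm]
      exact ENNReal.ofReal_le_ofReal (hmin hx)

end

omit [NormedSpace ℂ E] [FiniteDimensional ℂ E] [IsManifold 𝓘(ℂ, E) ω M] [MeasurableSpace E] [BorelSpace E]
  [MeasurableSpace M] [BorelSpace M] in
variable (E M) in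
-- The index type `Fin (n + 1)` is ordered with a least element, so that `disjointed` applies and
-- leaves the first piece unchanged.
theorem exists_compact_cover_subordinate_chartAt [T2Space M] [CompactSpace M] [Nonempty M] :
    ∃ (n : ℕ) (x : Fin (n + 1) → M) (K : Fin (n + 1) → Set M), (∀ i, IsCompact (K i)) ∧
      (∀ i, K i ∈ 𝓝 (x i)) ∧ (∀ i, K i ⊆ (chartAt E (x i)).source) ∧ ⋃ i, K i = Set.univ := by
  have h (x : M) := local_compact_nhds (chart_source_mem_nhds E x)
  choose K hKn hKs hKc using h
  obtain ⟨t, -, ht⟩ := isCompact_univ.elim_nhds_subcover K fun x _ => hKn x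
  have ht₀ : t.card ≠ 0 := by
    obtain ⟨x⟩ := ‹Nonempty M›
    have := ht (Set.mem_univ x)
    simp only [Set.mem_iUnion] at this
    obtain ⟨y, hy, -⟩ := this
    exact Finset.card_ne_zero_of_mem hy
  obtain ⟨n, hn⟩ := Nat.exists_eq_succ_of_ne_zero ht₀
  let e := (t.equivFinOfCardEq hn).symm
  refine ⟨n, fun i => e i, fun i => K (e i), fun i => hKc _, fun i => hKn _, fun i => hKs _,
    Set.eq_univ_of_forall fun x => ?_⟩
  have := ht (Set.mem_univ x)
  simp only [Set.mem_iUnion] at this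
  obtain ⟨y, hy, hxy⟩ := this
  exact Set.mem_iUnion.2 ⟨e.symm ⟨y, hy⟩, by simpa using hxy⟩

omit [MeasurableSpace E] [BorelSpace E] [MeasurableSpace M] [BorelSpace M] in
/-- If an automorphism of a compact complex manifold multiplies a nowhere zero holomorphic form of
top degree by a constant, then this constant has absolute value `1`. -/
theorem norm_eq_one_of_jacobianDet_mul_eq [T2Space M] [CompactSpace M] [Nonempty M]
    {s : M → ℂ} (hs : ∀ x, IsHolomorphicPluricanonicalAt 𝓘(ℂ, E) 1 s x) (hs₀ : ∀ x, s x ≠ 0)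
    (f : M ≃ₘ^ω⟮𝓘(ℂ, E), 𝓘(ℂ, E)⟯ M) {lam : ℂ}
    (hf : ∀ x, jacobianDet 𝓘(ℂ, E) f x * s (f x) = lam * s x) : ‖lam‖ = 1 := by
  borelize E M
  obtain ⟨n, x, K, hKc, hKn, hKs, hKu⟩ := exists_compact_cover_subordinate_chartAt E M
  have hKm (i) : MeasurableSet (K i) := (hKc i).isClosed.measurableSet
  -- Volumes are defined chart by chart, so `M` is cut into measurable pieces that each lie in one
  -- chart.
  set A : Fin (n + 1) → Set M := disjointed K with hA
  have hAm (i) : MeasurableSet (A i) := disjointedRec (fun _ j h => h.diff (hKm j)) (hKm i)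
  have hAK (i) : A i ⊆ K i := disjointed_le K i
  have hAd : Pairwise (Function.onFun Disjoint A) := disjoint_disjointed K
  have hAu : ⋃ i, A i = Set.univ := by rw [← hKu]; exact iSup_disjointed K
  have hfm : Measurable f := f.continuous.measurable
  -- Refining by both `A i` and `f ⁻¹' A j` puts each piece and its image in single charts.
  have hdec (j) : A j = ⋃ i, f '' (A i ∩ f ⁻¹' A j) := by
    rw [← Set.image_iUnion, ← Set.iUnion_inter, hAu, Set.univ_inter,
      show f '' (f ⁻¹' A j) = A j from Set.image_preimage_eq _ f.toEquiv.surjective]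
  have hinter (i) : A i = ⋃ j, A i ∩ f ⁻¹' A j := by
    rw [← Set.inter_iUnion, ← Set.preimage_iUnion, hAu, Set.preimage_univ, Set.inter_univ]
  have hmeas (i j) : MeasurableSet (A i ∩ f ⁻¹' A j) := (hAm i).inter (hfm (hAm j))
  have hsub (i j) : f '' (A i ∩ f ⁻¹' A j) ⊆ A j := by
    rintro _ ⟨y, hy, rfl⟩
    exact hy.2
  set c : ℝ≥0∞ := ‖lam‖ₑ ^ 2 with hc
  have hfimg (i j) : f '' (A i ∩ f ⁻¹' A j) = f.symm ⁻¹' (A i ∩ f ⁻¹' A j) :=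
    f.toEquiv.image_eq_preimage_symm _
  have key : ∑ j, formVolume E s (x j) (A j) = c * ∑ i, formVolume E s (x i) (A i) := by
    calc ∑ j, formVolume E s (x j) (A j)
        = ∑ j, ∑ i, formVolume E s (x j) (f '' (A i ∩ f ⁻¹' A j)) := by
          refine Finset.sum_congr rfl fun j _ => ?_
          conv_lhs => rw [hdec j]
          refine formVolume_iUnion (fun i => ?_) (fun i i' hi => ?_)
            fun i => ((hsub i j).trans (hAK j)).trans (hKs j)
          · rw [hfimg]
            exact f.symm.continuous.measurable (hmeas i j)
          · exact (Set.disjoint_image_iff f.injective).2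
              ((hAd hi).mono Set.inter_subset_left Set.inter_subset_left)
      _ = ∑ j, ∑ i, c * formVolume E s (x i) (A i ∩ f ⁻¹' A j) := by
          refine Finset.sum_congr rfl fun j _ => Finset.sum_congr rfl fun i _ => ?_
          exact formVolume_image (hmeas i j) f.contMDiff f.injective
            ((Set.inter_subset_left.trans (hAK i)).trans (hKs i))
            (((hsub i j).trans (hAK j)).trans (hKs j)) fun y _ => hf y
      _ = c * ∑ i, formVolume E s (x i) (A i) := by
          rw [Finset.sum_comm, Finset.mul_sum]
          refine Finset.sum_congr rfl fun i _ => ?_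
          rw [← Finset.mul_sum]
          congr 1
          conv_rhs => rw [hinter i]
          refine (formVolume_iUnion (fun j => hmeas i j) (fun j j' hj => ?_) fun j =>
            (Set.inter_subset_left.trans (hAK i)).trans (hKs i)).symm
          exact ((hAd hj).preimage f).mono Set.inter_subset_right Set.inter_subset_right
  have hfin : ∑ i, formVolume E s (x i) (A i) ≠ ⊤ := by
    refine ENNReal.sum_ne_top.2 fun i _ => ne_of_lt ?_
    exact (formVolume_mono (hAK i)).trans_lt (formVolume_lt_top_of_isCompact hs (hKc i) (hKs i))
  have hpos : ∑ i, formVolume E s (x i) (A i) ≠ 0 := by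
    refine fun h => (formVolume_pos_of_isCompact hs (hKc 0) (hKs 0) hs₀ (hKn 0)).ne' ?_
    -- The first piece `A 0` is all of `K 0`, a neighbourhood of `x 0`, so it has positive volume.
    have h₀ := (Finset.sum_eq_zero_iff.1 h) 0 (Finset.mem_univ _)
    rwa [hA, show (0 : Fin (n + 1)) = ⊥ from rfl, disjointed_bot] at h₀
  have hc₁ : c = 1 := by
    have h := key.symm
    nth_rewrite 2 [← one_mul (∑ i, formVolume E s (x i) (A i))] at h
    exact (ENNReal.mul_left_inj hpos hfin).1 h
  rw [hc, ← ofReal_norm, ← ENNReal.ofReal_pow (norm_nonneg _), ENNReal.ofReal_eq_one] at hc₁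
  exact (pow_eq_one_iff_of_nonneg (norm_nonneg _) two_ne_zero).1 hc₁

end FormVolume

/-! ### Pluricanonical sections on a quotient by a free properly discontinuous action. -/

section QuotientSections

variable {E : Type*} [NormedAddCommGroup E] [NormedSpace ℂ E]
  {H : Type*} [TopologicalSpace H] (I : ModelWithCorners ℂ E H)
  {Y : Type*} [TopologicalSpace Y] [T2Space Y] [LocallyCompactSpace Y] [ChartedSpace H Y]
  [IsManifold I ω Y] {G : Type*} [AddGroup G] [AddAction G Y]
  [ProperlyDiscontinuousVAdd G Y] [ContinuousConstVAdd G Y] [IsCancelVAdd G Y]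
  [IsManifold I ω (AddAction.orbitRel.Quotient G Y)]

open AddAction in
-- The preferred chart at `x` is a local inverse of the projection followed by a chart of `Y`. In
-- these charts both that inverse and the projection are the identity.
theorem exists_contMDiff_section_quotientMk (x : orbitRel.Quotient G Y) :
    ∃ ρ : orbitRel.Quotient G Y → Y, ∃ U ∈ 𝓝 x, IsOpen U ∧
      (∀ x' ∈ U, (Quotient.mk _ (ρ x') : orbitRel.Quotient G Y) = x' ∧ ContMDiffAt I I ω ρ x') ∧
      ContMDiffAt I I ω (Quotient.mk _ : Y → orbitRel.Quotient G Y) (ρ x) := by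
  have hloc := (isAddQuotientCoveringMap_quotientMk_of_properlyDiscontinuousVAdd
    (G := G) (E := Y)).isCoveringMap.isLocalHomeomorph
  set p := (Quotient.mk_surjective (s := orbitRel G Y)).hasRightInverse.choose x with hp
  set e := hloc.localInverseAt p with he
  have hchart : chartAt H x = e.trans (chartAt H p) := rfl
  have hx := mem_chart_source H x
  have hU := (chartAt H x).open_source
  have hsource : ∀ x' ∈ (chartAt H x).source, x' ∈ e.source ∧ e x' ∈ (chartAt H p).source := by
    intro x' hx'
    rw [hchart] at hx'
    simpa using hx'
  have hsymm : (e.symm : Y → orbitRel.Quotient G Y) = Quotient.mk _ := hloc.localInverseAt_symm p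
  refine ⟨e, (chartAt H x).source, hU.mem_nhds hx, hU, fun x' hx' => ⟨?_, ?_⟩, ?_⟩
  · rw [← hsymm]
    exact e.left_inv (hsource x' hx').1
  · have h₁ : ContMDiffAt I I ω (chartAt H x) x' := contMDiffOn_chart.contMDiffAt (hU.mem_nhds hx')
    have h₂ : ContMDiffAt I I ω (chartAt H p).symm (chartAt H x x') := by
      refine contMDiffOn_chart_symm.contMDiffAt ((chartAt H p).open_target.mem_nhds ?_)
      exact (chartAt H p).map_source (hsource x' hx').2
    refine (h₂.comp x' h₁).congr_of_eventuallyEq ?_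
    filter_upwards [hU.mem_nhds hx'] with y hy
    exact ((chartAt H p).left_inv (hsource y hy).2).symm
  · have hex := (hsource x hx).2
    have h₁ : ContMDiffAt I I ω (chartAt H p) (e x) :=
      contMDiffOn_chart.contMDiffAt ((chartAt H p).open_source.mem_nhds hex)
    have h₂ : ContMDiffAt I I ω (chartAt H x).symm (chartAt H p (e x)) := by
      refine contMDiffOn_chart_symm.contMDiffAt ((chartAt H x).open_target.mem_nhds ?_)
      exact (chartAt H x).map_source hx
    refine (h₂.comp (e x) h₁).congr_of_eventuallyEq ?_
    filter_upwards [(chartAt H p).open_source.mem_nhds hex] with y hy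
    rw [← hsymm]
    simp [hchart, hy]

variable (hG : ∀ g : G, ContMDiff I I ω (fun y : Y => g +ᵥ y))

include hG

omit [T2Space Y] [LocallyCompactSpace Y] [IsManifold I ω Y] [ProperlyDiscontinuousVAdd G Y]
  [ContinuousConstVAdd G Y] [IsCancelVAdd G Y]
  [IsManifold I ω (AddAction.orbitRel.Quotient G Y)] in
theorem jacobianDet_vadd_ne_zero (g : G) (y : Y) :
    jacobianDet I (fun y : Y => g +ᵥ y) y ≠ 0 := by
  have h := jacobianDet_comp I (ψ := fun y : Y => -g +ᵥ y) (hG (-g) _) (hG g y)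
  have h₁ : (fun y : Y => -g +ᵥ y) ∘ (fun y : Y => g +ᵥ y) = id := by
    funext y
    simp
  rw [h₁, jacobianDet_id] at h
  exact right_ne_zero_of_mul_eq_one h.symm

open AddAction in
-- Holomorphy is known at the point of the orbit chosen by the chart; the group element moving `y`
-- there transfers it to `y`.
theorem contMDiff_quotientMk :
    ContMDiff I I ω (Quotient.mk _ : Y → orbitRel.Quotient G Y) := by
  intro y
  obtain ⟨ρ, U, hU, -, hρ, hmk⟩ := exists_contMDiff_section_quotientMk I
    (Quotient.mk _ y : orbitRel.Quotient G Y)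
  obtain ⟨g, hg⟩ : ∃ g : G, g +ᵥ y = ρ (Quotient.mk _ y) :=
    Quotient.exact (hρ _ (mem_of_mem_nhds hU)).1
  rw [← hg] at hmk
  refine (hmk.comp y (hG g y)).congr_of_eventuallyEq (.of_eq ?_)
  funext z
  exact (Quotient.sound (s := orbitRel G Y) ⟨g, rfl⟩).symm

open AddAction in
theorem jacobianDet_quotientMk_vadd (g : G) (y : Y) :
    jacobianDet I (Quotient.mk _ : Y → orbitRel.Quotient G Y) (g +ᵥ y) *
        jacobianDet I (fun y : Y => g +ᵥ y) y =
      jacobianDet I (Quotient.mk _ : Y → orbitRel.Quotient G Y) y := by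
  rw [← jacobianDet_comp I (χ := fun y : Y => g +ᵥ y) (contMDiff_quotientMk I hG _) (hG g y)]
  congr 1
  funext z
  exact Quotient.sound (s := orbitRel G Y) ⟨g, rfl⟩

open AddAction in
theorem jacobianDet_quotientMk_mul_section {ρ : orbitRel.Quotient G Y → Y}
    {x : orbitRel.Quotient G Y}
    (h : ∀ᶠ x' in 𝓝 x, (Quotient.mk _ (ρ x') : orbitRel.Quotient G Y) = x')
    (hρ : ContMDiffAt I I ω ρ x) :
    jacobianDet I (Quotient.mk _ : Y → orbitRel.Quotient G Y) (ρ x) * jacobianDet I ρ x = 1 := by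
  rw [← jacobianDet_comp I (contMDiff_quotientMk I hG _) hρ, ← jacobianDet_id I x]
  exact jacobianDet_congr I h

open AddAction in
theorem jacobianDet_quotientMk_ne_zero (y : Y) :
    jacobianDet I (Quotient.mk _ : Y → orbitRel.Quotient G Y) y ≠ 0 := by
  obtain ⟨ρ, U, hU, -, hρ, -⟩ := exists_contMDiff_section_quotientMk I
    (Quotient.mk _ y : orbitRel.Quotient G Y)
  have hy := hρ _ (mem_of_mem_nhds hU)
  obtain ⟨g, hg⟩ : ∃ g : G, g +ᵥ y = ρ (Quotient.mk _ y) := Quotient.exact hy.1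
  have h := jacobianDet_quotientMk_mul_section I hG
    (Filter.mem_of_superset hU fun x' hx' => (hρ x' hx').1) hy.2
  rw [← jacobianDet_quotientMk_vadd I hG g y, hg]
  exact mul_ne_zero (left_ne_zero_of_mul_eq_one h) (jacobianDet_vadd_ne_zero I hG g y)

open AddAction in
/-- An invariant holomorphic section of `K_Y^{⊗ m}` descends to the quotient. -/
theorem exists_pullback_quotientMk_eq [FiniteDimensional ℂ E] {m : ℕ} {t : Y → ℂ}
    (ht : ∀ y, IsHolomorphicPluricanonicalAt I m t y)
    (hinv : ∀ (g : G) (y : Y), jacobianDet I (fun y : Y => g +ᵥ y) y ^ m * t (g +ᵥ y) = t y) :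
    ∃ s : orbitRel.Quotient G Y → ℂ, (∀ x, IsHolomorphicPluricanonicalAt I m s x) ∧
      ∀ y, jacobianDet I (Quotient.mk _ : Y → orbitRel.Quotient G Y) y ^ m *
        s (Quotient.mk _ y) = t y := by
  -- The descended coefficient must be `t` divided by the power of the Jacobian of the projection;
  -- invariance makes this constant on orbits.
  have hne (y : Y) := pow_ne_zero m (jacobianDet_quotientMk_ne_zero I hG y)
  have hlift : ∀ y y' : Y, orbitRel G Y y y' →
      t y / jacobianDet I (Quotient.mk _ : Y → orbitRel.Quotient G Y) y ^ m =
      t y' / jacobianDet I (Quotient.mk _ : Y → orbitRel.Quotient G Y) y' ^ m := by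
    rintro _ y ⟨g, rfl⟩
    rw [div_eq_div_iff (hne _) (hne _), ← hinv g y, ← jacobianDet_quotientMk_vadd I hG g y]
    ring
  refine ⟨Quotient.lift _ hlift, fun x => ?_, fun y => mul_div_cancel₀ _ (hne y)⟩
  obtain ⟨ρ, U, hU, hUo, hρ, -⟩ := exists_contMDiff_section_quotientMk I x
  -- Near `x` the descended section is the pullback of `t` by the local section `ρ`.
  refine ((ht (ρ x)).pullback I (hρ x (mem_of_mem_nhds hU)).2).congr I ?_
  filter_upwards [hU] with x' hx'
  have h := jacobianDet_quotientMk_mul_section I hG (ρ := ρ) (x := x')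
    (Filter.mem_of_superset (hUo.mem_nhds hx') fun x'' hx'' => (hρ x'' hx'').1) (hρ x' hx').2
  nth_rewrite 1 [← (hρ x' hx').1]
  rw [Quotient.lift_mk, div_eq_iff (hne _)]
  have h' := congrArg (· ^ m) h
  simp only [mul_pow, one_pow] at h'
  linear_combination -(t (ρ x')) * h'

end QuotientSections

/-! ### Forms and functions on `M × V`, and iterates of `f`. -/

section Product

variable {E : Type*} [NormedAddCommGroup E] [NormedSpace ℂ E]
  {M : Type*} [TopologicalSpace M] [ChartedSpace E M]
  {V : Type*} [NormedAddCommGroup V] [NormedSpace ℂ V]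

theorem ContinuousLinearMap.det_prodMap [FiniteDimensional ℂ E] [FiniteDimensional ℂ V]
    (A : E →L[ℂ] E) (B : V →L[ℂ] V) : (A.prodMap B).det = A.det * B.det :=
  LinearMap.det_prodMap (A : E →ₗ[ℂ] E) (B : V →ₗ[ℂ] V)

/-- `V` has a single chart, so only the `M` factor contributes; uniqueness of derivatives concludes.
-/
theorem tangentCoordChange_prod [IsManifold 𝓘(ℂ, E) ω M] {p₀ p : M × V}
    (hp : p.1 ∈ (chartAt E p₀.1).source) :
    tangentCoordChange (𝓘(ℂ, E).prod 𝓘(ℂ, V)) p₀ p p =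
      (tangentCoordChange 𝓘(ℂ, E) p₀.1 p.1 p.1).prodMap (ContinuousLinearMap.id ℂ V) := by
  have h₁ := hasFDerivWithinAt_tangentCoordChange (I := 𝓘(ℂ, E).prod 𝓘(ℂ, V)) (x := p₀) (y := p)
    (z := p) (by
      rw [extChartAt_source, extChartAt_source]
      exact ⟨⟨hp, Set.mem_univ _⟩, mem_chart_source _ p⟩)
  have h₂ := hasFDerivWithinAt_tangentCoordChange (I := 𝓘(ℂ, E)) (x := p₀.1) (y := p.1)
    (z := p.1) (by simp [hp])
  have hr : Set.range (𝓘(ℂ, E).prod 𝓘(ℂ, V)) = Set.univ :=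
    ModelWithCorners.Boundaryless.range_eq_univ
  rw [hr, hasFDerivWithinAt_univ] at h₁
  simp only [modelWithCornersSelf_coe, Set.range_id, hasFDerivWithinAt_univ] at h₂
  exact h₁.unique (HasFDerivAt.prodMap (p := (extChartAt 𝓘(ℂ, E) p₀.1 p.1, p.2)) h₂
    (hasFDerivAt_id p.2))

theorem IsHolomorphicPluricanonicalAt.comp_fst [IsManifold 𝓘(ℂ, E) ω M]
    [FiniteDimensional ℂ E] [FiniteDimensional ℂ V] {m : ℕ} {s : M → ℂ} {p₀ : M × V}
    (hs : IsHolomorphicPluricanonicalAt 𝓘(ℂ, E) m s p₀.1) :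
    IsHolomorphicPluricanonicalAt (𝓘(ℂ, E).prod 𝓘(ℂ, V)) m (fun p : M × V => s p.1) p₀ := by
  refine (ContMDiffAt.comp p₀ (g := pluricanonicalCoeff 𝓘(ℂ, E) m s p₀.1) hs
    contMDiffAt_fst).congr_of_eventuallyEq ?_
  filter_upwards [continuousAt_fst.eventually ((chartAt E p₀.1).open_source.mem_nhds
    (mem_chart_source E p₀.1))] with p hp
  simp only [pluricanonicalCoeff, Function.comp_apply]
  rw [tangentCoordChange_prod hp, ContinuousLinearMap.det_prodMap, ContinuousLinearMap.det_id,
    mul_one]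

theorem jacobianDet_prodMap_add_const [FiniteDimensional ℂ E] [FiniteDimensional ℂ V]
    {g : M → M} (hg : ContMDiff 𝓘(ℂ, E) 𝓘(ℂ, E) ω g) (v : V) (p : M × V) :
    jacobianDet (𝓘(ℂ, E).prod 𝓘(ℂ, V)) (fun p : M × V => (g p.1, p.2 + v)) p =
      jacobianDet 𝓘(ℂ, E) g p.1 := by
  have h₁ : MDifferentiableAt 𝓘(ℂ, E) 𝓘(ℂ, E) g p.1 := (hg p.1).mdifferentiableAt (by simp)
  have h₂ : HasFDerivAt (fun w : V => w + v) (ContinuousLinearMap.id ℂ V) p.2 :=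
    (hasFDerivAt_id p.2).add_const v
  have h₃ : chartDeriv 𝓘(ℂ, V) (fun w : V => w + v) p.2 = ContinuousLinearMap.id ℂ V :=
    h₂.hasMFDerivAt.mfderiv
  have h : chartDeriv (𝓘(ℂ, E).prod 𝓘(ℂ, V)) (fun p : M × V => (g p.1, p.2 + v)) p =
      (chartDeriv 𝓘(ℂ, E) g p.1).prodMap (chartDeriv 𝓘(ℂ, V) (fun w : V => w + v) p.2) :=
    mfderiv_prodMap h₁ h₂.hasMFDerivAt.mdifferentiableAt
  rw [jacobianDet, h, h₃, ContinuousLinearMap.det_prodMap, ContinuousLinearMap.det_id, mul_one,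
    jacobianDet]

/-- A holomorphic function on `M × V`, with `M` compact and connected, is constant if its norm is
periodic up to maps of `M`. -/
theorem apply_eq_of_norm_periodic [IsManifold 𝓘(ℂ, E) ω M] [CompactSpace M] [ConnectedSpace M]
    [FiniteDimensional ℂ V] (Γ : Submodule ℤ V) [DiscreteTopology Γ] [IsZLattice ℝ Γ]
    {h : M × V → ℂ} (hh : ContMDiff (𝓘(ℂ, E).prod 𝓘(ℂ, V)) 𝓘(ℂ, ℂ) ω h)
    (hper : ∀ w ∈ Γ, ∃ g : M → M, ∀ z t, ‖h (g z, t + w)‖ = ‖h (z, t)‖) (p q : M × V) :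
    h p = h q := by
  obtain ⟨z₀⟩ := (inferInstance : Nonempty M)
  have hfst (z z' : M) (t : V) : h (z, t) = h (z', t) := by
    have h₁ : ContMDiff 𝓘(ℂ, E) 𝓘(ℂ, ℂ) ω fun z : M => h (z, t) :=
      hh.comp (contMDiff_id.prodMk contMDiff_const)
    exact (h₁.mdifferentiable (by simp)).apply_eq_of_compactSpace z z'
  have hsnd (t t' : V) : h (z₀, t) = h (z₀, t') := by
    have h₁ : ContMDiff 𝓘(ℂ, V) 𝓘(ℂ, ℂ) ω fun t : V => h (z₀, t) :=
      hh.comp (contMDiff_const.prodMk contMDiff_id)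
    have hd : Differentiable ℂ fun t : V => h (z₀, t) :=
      (contMDiff_iff_contDiff.1 h₁).differentiable (by simp)
    have : FiniteDimensional ℝ V := FiniteDimensional.complexToReal V
    -- Independence of the `M` coordinate removes the twist `g`, leaving true periodicity in `t`.
    have hc := IsZLattice.isCompact_range_of_periodic Γ (fun t : V => ‖h (z₀, t)‖)
      hd.continuous.norm fun t w hw => by
        obtain ⟨g, hg⟩ := hper w hw
        rw [← hg z₀ t, hfst (g z₀) z₀]
    obtain ⟨C, hC⟩ := hc.isBounded.exists_norm_le
    refine hd.apply_eq_apply_of_bounded ((isBounded_iff_forall_norm_le).2 ⟨C, ?_⟩) t t'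
    rintro _ ⟨t, rfl⟩
    simpa using hC _ ⟨t, rfl⟩
  exact (hfst p.1 z₀ p.2).trans ((hsnd p.2 q.2).trans (hfst z₀ q.1 q.2))

theorem jacobianDet_zpow_mul_eq [IsManifold 𝓘(ℂ, E) ω M] (f : M ≃ₘ^ω⟮𝓘(ℂ, E), 𝓘(ℂ, E)⟯ M)
    {s : M → ℂ} (hs₀ : ∀ x, s x ≠ 0) {lam : ℂ} (hlam : lam ≠ 0)
    (hf : ∀ x, jacobianDet 𝓘(ℂ, E) f x * s (f x) = lam * s x) (k : ℤ) (x : M) :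
    jacobianDet 𝓘(ℂ, E) (f.toHomeomorph ^ k : M ≃ₜ M) x * s ((f.toHomeomorph ^ k : M ≃ₜ M) x) =
      lam ^ k * s x := by
  have hsucc (k : ℤ) : ((f.toHomeomorph ^ (k + 1) : M ≃ₜ M) : M → M) =
      ((f.toHomeomorph ^ k : M ≃ₜ M) : M → M) ∘ f := by
    rw [zpow_add_one]
    rfl
  have hjac (k : ℤ) (x : M) : jacobianDet 𝓘(ℂ, E) (f.toHomeomorph ^ (k + 1) : M ≃ₜ M) x =
      jacobianDet 𝓘(ℂ, E) (f.toHomeomorph ^ k : M ≃ₜ M) (f x) * jacobianDet 𝓘(ℂ, E) f x := by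
    rw [hsucc]
    exact jacobianDet_comp _ (TwistedProduct.contMDiff_zpow f k _) (f.contMDiff x)
  induction k using Int.induction_on generalizing x with
  | zero =>
    have : jacobianDet 𝓘(ℂ, E) ((f.toHomeomorph ^ (0 : ℤ) : M ≃ₜ M) : M → M) x = 1 := by
      rw [zpow_zero]
      exact jacobianDet_id _ x
    rw [this, zpow_zero, zpow_zero]
    rfl
  | succ k ih =>
    rw [hjac, hsucc, zpow_add_one₀ hlam, Function.comp_apply]
    linear_combination jacobianDet 𝓘(ℂ, E) f x * ih (f x) + lam ^ (k : ℤ) * hf x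
  | pred k ih =>
    -- Descending from `-k` to `-k - 1`: write the point as `f y`, use the case `-k` at `y`, and
    -- cancel the nonzero Jacobian of `f`.
    obtain ⟨y, rfl⟩ := f.surjective x
    have h := ih y
    have hk : (-k : ℤ) = (-k - 1 : ℤ) + 1 := by ring
    rw [hk, hjac, hsucc, zpow_add_one₀ hlam, Function.comp_apply] at h
    have hne : jacobianDet 𝓘(ℂ, E) f y ≠ 0 := by
      intro h₀
      have := hf y
      rw [h₀, zero_mul] at this
      exact mul_ne_zero hlam (hs₀ y) this.symm
    apply mul_left_cancel₀ hne
    linear_combination h - lam ^ (-k - 1 : ℤ) * hf y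

end Product

/-! ### Plurigenera of the twisted quotient. -/

section TwistedQuotientSections

open AddAction

variable {E : Type*} [NormedAddCommGroup E] [NormedSpace ℂ E] [FiniteDimensional ℂ E]
  {M : Type*} [TopologicalSpace M] [T2Space M] [CompactSpace M]
  [ChartedSpace E M] [IsManifold 𝓘(ℂ, E) ω M]
  (f : M ≃ₘ^ω⟮𝓘(ℂ, E), 𝓘(ℂ, E)⟯ M)
  {V : Type*} [NormedAddCommGroup V] [NormedSpace ℂ V] [FiniteDimensional ℂ V]
  {Γ : Submodule ℤ V} [DiscreteTopology Γ]
  {ι : Type*} [Fintype ι] (b : Module.Basis ι ℤ Γ)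

omit [CompactSpace M] [T2Space M] [IsManifold 𝓘(ℂ, E) ω M] [DiscreteTopology Γ] in
theorem jacobianDet_twistedProduct_vadd (γ : Γ) (p : TwistedProduct f b) :
    jacobianDet (𝓘(ℂ, E).prod 𝓘(ℂ, V)) (fun p : TwistedProduct f b => γ +ᵥ p) p =
      jacobianDet 𝓘(ℂ, E) (f.toHomeomorph ^ latticeDegree b γ : M ≃ₜ M) p.1 :=
  jacobianDet_prodMap_add_const (TwistedProduct.contMDiff_zpow f (latticeDegree b γ)) (γ : V) p

omit [T2Space M] [CompactSpace M] [DiscreteTopology Γ] [Fintype ι] in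
theorem isHolomorphicPluricanonicalAt_twistedProduct {s : M → ℂ}
    (hs : ∀ x, IsHolomorphicPluricanonicalAt 𝓘(ℂ, E) 1 s x) (m : ℕ) (p : TwistedProduct f b) :
    IsHolomorphicPluricanonicalAt (𝓘(ℂ, E).prod 𝓘(ℂ, V)) m
      (fun p : TwistedProduct f b => s p.1 ^ m) p := by
  have h := (hs p.1).pow 𝓘(ℂ, E) m
  rw [one_mul] at h
  exact h.comp_fst (V := V) (p₀ := p)

section

variable {s : M → ℂ} (hs₀ : ∀ x, s x ≠ 0) {lam : ℂ} (hlam : lam ≠ 0)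
  (hf : ∀ x, jacobianDet 𝓘(ℂ, E) f x * s (f x) = lam * s x)
include hs₀ hlam hf

omit [T2Space M] [CompactSpace M] [DiscreteTopology Γ] in
theorem jacobianDet_twistedProduct_vadd_pow_mul (m : ℕ) (γ : Γ) (p : TwistedProduct f b) :
    jacobianDet (𝓘(ℂ, E).prod 𝓘(ℂ, V)) (fun p : TwistedProduct f b => γ +ᵥ p) p ^ m *
      s (γ +ᵥ p).1 ^ m = (lam ^ latticeDegree b γ) ^ m * s p.1 ^ m := by
  rw [jacobianDet_twistedProduct_vadd, ← mul_pow, ← mul_pow,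
    ← jacobianDet_zpow_mul_eq f hs₀ hlam hf]
  rfl

/-- On the product `M × V`, a pluricanonical section of the twisted quotient is a constant multiple
of `σ^{⊗ m} ⊗ (dt₁ ∧ ⋯ ∧ dt_p)^{⊗ m}`. -/
theorem exists_pullback_eq_const_mul [ConnectedSpace M] [IsZLattice ℝ Γ]
    (hs : ∀ x, IsHolomorphicPluricanonicalAt 𝓘(ℂ, E) 1 s x) (hnorm : ‖lam‖ = 1) {m : ℕ}
    {u : TwistedQuotient f b → ℂ}
    (hu : ∀ x, IsHolomorphicPluricanonicalAt (𝓘(ℂ, E).prod 𝓘(ℂ, V)) m u x) :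
    ∃ C : ℂ, (∀ p : TwistedProduct f b, jacobianDet (𝓘(ℂ, E).prod 𝓘(ℂ, V))
      (Quotient.mk _ : TwistedProduct f b → TwistedQuotient f b) p ^ m * u (Quotient.mk _ p) =
        C * s p.1 ^ m) ∧ ∀ γ : Γ, C * (lam ^ latticeDegree b γ) ^ m = C := by
  set π : TwistedProduct f b → TwistedQuotient f b := Quotient.mk _ with hπ
  -- The coefficient of `dt₁ ∧ ⋯ ∧ dt_p` is `1`, so the reference section has coefficient `s p.1 ^
  -- m`.
  set h : TwistedProduct f b → ℂ := fun p =>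
    jacobianDet (𝓘(ℂ, E).prod 𝓘(ℂ, V)) π p ^ m * u (π p) / s p.1 ^ m with hh
  have hG := TwistedProduct.contMDiff_vadd f b
  have hsm (x : M) : s x ^ m ≠ 0 := pow_ne_zero m (hs₀ x)
  have hhol : ContMDiff (𝓘(ℂ, E).prod 𝓘(ℂ, V)) 𝓘(ℂ, ℂ) ω h := fun p =>
    ((hu (π p)).pullback _ (contMDiff_quotientMk _ hG p)).div _
      (isHolomorphicPluricanonicalAt_twistedProduct f b hs m p) (hsm _)
  have hinv (γ : Γ) (p : TwistedProduct f b) :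
      h (γ +ᵥ p) * (lam ^ latticeDegree b γ) ^ m = h p := by
    have h₁ := jacobianDet_twistedProduct_vadd_pow_mul f b hs₀ hlam hf m γ p
    have h₂ := jacobianDet_quotientMk_vadd _ hG γ p
    have h₃ : π (γ +ᵥ p) = π p := Quotient.sound (s := orbitRel Γ (TwistedProduct f b)) ⟨γ, rfl⟩
    have hsγ := hsm (γ +ᵥ p).1
    have hsp := hsm p.1
    simp only [hh]
    rw [h₃, eq_div_iff hsp, div_mul_eq_mul_div, div_mul_eq_mul_div,
      div_eq_iff hsγ, mul_assoc, ← h₁, ← h₂]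
    ring
  have hconst (p q : TwistedProduct f b) : h p = h q := by
    refine apply_eq_of_norm_periodic (E := E) Γ (h := h) hhol (fun w hw => ?_) p q
    refine ⟨(f.toHomeomorph ^ latticeDegree b ⟨w, hw⟩ : M ≃ₜ M), fun z t => ?_⟩
    have h₂ := congrArg norm (hinv ⟨w, hw⟩ ((z, t) : M × V))
    -- Only here is `|λ| = 1` needed: the automorphy factor disappears from the norm.
    rw [norm_mul, norm_pow, norm_zpow, hnorm, one_zpow, one_pow, mul_one] at h₂
    exact h₂
  obtain ⟨z₀⟩ := (inferInstance : Nonempty M)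
  let p₀ : TwistedProduct f b := ((z₀, 0) : M × V)
  refine ⟨h p₀, fun p => ?_, fun γ => ?_⟩
  · have hsp := hsm p.1
    rw [hconst p₀ p]
    exact (div_mul_cancel₀ _ hsp).symm
  · have := hinv γ p₀
    rwa [hconst (γ +ᵥ p₀) p₀] at this

variable [ConnectedSpace M] [IsZLattice ℝ Γ]
  (hs : ∀ x, IsHolomorphicPluricanonicalAt 𝓘(ℂ, E) 1 s x) (hnorm : ‖lam‖ = 1)
include hs hnorm

/-- The reference form vanishes nowhere, so one zero forces the constant `C` to vanish. Evaluation
at a point is therefore injective, which bounds `P_m` by `1`. -/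
theorem pluricanonicalSection_eq_zero_of_apply_eq_zero {m : ℕ}
    (u : PluricanonicalSection (𝓘(ℂ, E).prod 𝓘(ℂ, V)) (TwistedQuotient f b) m)
    {x₀ : TwistedQuotient f b} (hu₀ : u x₀ = 0) : u = 0 := by
  have hG := TwistedProduct.contMDiff_vadd f b
  obtain ⟨C, hC, -⟩ := exists_pullback_eq_const_mul f b hs₀ hlam hf hs hnorm (m := m) (u := u)
    fun x => (pluricanonicalSection_contMDiffAt_iff _).1 (u.contMDiff x)
  obtain ⟨p₀, rfl⟩ := Quotient.exists_rep x₀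
  have hC₀ : C = 0 := by
    have h := (hC p₀).symm.trans (mul_eq_zero_of_right _ hu₀)
    exact (mul_eq_zero.1 h).resolve_right (pow_ne_zero m (hs₀ _))
  ext x
  obtain ⟨p, rfl⟩ := Quotient.exists_rep x
  have h := hC p
  rw [hC₀, zero_mul] at h
  exact (mul_eq_zero.1 h).resolve_left
    (pow_ne_zero m (jacobianDet_quotientMk_ne_zero _ hG p))

theorem rank_pluricanonicalSection_le_one (m : ℕ) :
    Module.rank ℂ (PluricanonicalSection (𝓘(ℂ, E).prod 𝓘(ℂ, V)) (TwistedQuotient f b) m) ≤ 1 := by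
  obtain ⟨z₀⟩ := (inferInstance : Nonempty M)
  let x₀ : TwistedQuotient f b := Quotient.mk _ ((z₀, 0) : M × V)
  let ev : PluricanonicalSection (𝓘(ℂ, E).prod 𝓘(ℂ, V)) (TwistedQuotient f b) m →ₗ[ℂ] ℂ :=
    { toFun := fun u => u x₀
      map_add' := fun _ _ => rfl
      map_smul' := fun _ _ => rfl }
  have hev : Function.Injective ev := (injective_iff_map_eq_zero ev).2 fun u hu =>
    pluricanonicalSection_eq_zero_of_apply_eq_zero f b hs₀ hlam hf hs hnorm u hu
  simpa using LinearMap.lift_rank_le_of_injective ev hev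

theorem subsingleton_pluricanonicalSection {m : ℕ} (hm : lam ^ m ≠ 1) {γ : Γ}
    (hγ : latticeDegree b γ = 1) :
    Subsingleton (PluricanonicalSection (𝓘(ℂ, E).prod 𝓘(ℂ, V)) (TwistedQuotient f b) m) := by
  refine subsingleton_of_forall_eq 0 fun u => ?_
  obtain ⟨z₀⟩ := (inferInstance : Nonempty M)
  let p₀ : TwistedProduct f b := ((z₀, 0) : M × V)
  obtain ⟨C, hC, hC'⟩ := exists_pullback_eq_const_mul f b hs₀ hlam hf hs hnorm (m := m) (u := u)
    fun x => (pluricanonicalSection_contMDiffAt_iff _).1 (u.contMDiff x)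
  have hC₀ : C = 0 := by
    have h := hC' γ
    rw [hγ, zpow_one] at h
    by_contra hne
    exact hm (mul_left_cancel₀ hne (h.trans (mul_one C).symm))
  refine pluricanonicalSection_eq_zero_of_apply_eq_zero f b hs₀ hlam hf hs hnorm u
    (x₀ := Quotient.mk _ p₀) ?_
  have h := hC p₀
  rw [hC₀, zero_mul] at h
  exact (mul_eq_zero.1 h).resolve_left (pow_ne_zero m
    (jacobianDet_quotientMk_ne_zero _ (TwistedProduct.contMDiff_vadd f b) p₀))

omit [ConnectedSpace M] [IsZLattice ℝ Γ] hnorm in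
-- When `λ^m = 1`, every automorphy factor is `1` and the reference form descends to a nonzero
-- section.
theorem nontrivial_pluricanonicalSection [Nonempty M] {m : ℕ} (hm : lam ^ m = 1) :
    Nontrivial (PluricanonicalSection (𝓘(ℂ, E).prod 𝓘(ℂ, V)) (TwistedQuotient f b) m) := by
  obtain ⟨z₀⟩ := (inferInstance : Nonempty M)
  let p₀ : TwistedProduct f b := ((z₀, 0) : M × V)
  obtain ⟨u, hu, hu'⟩ := exists_pullback_quotientMk_eq (𝓘(ℂ, E).prod 𝓘(ℂ, V))
    (TwistedProduct.contMDiff_vadd f b)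
    (isHolomorphicPluricanonicalAt_twistedProduct f b hs m) fun γ p => by
      have h : (lam ^ latticeDegree b γ) ^ m = 1 := by
        rw [← zpow_natCast, ← zpow_mul, mul_comm, zpow_mul, zpow_natCast, hm, one_zpow]
      rw [jacobianDet_twistedProduct_vadd_pow_mul f b hs₀ hlam hf, h, one_mul]
  let w : PluricanonicalSection (𝓘(ℂ, E).prod 𝓘(ℂ, V)) (TwistedQuotient f b) m :=
    ⟨u, fun x => (pluricanonicalSection_contMDiffAt_iff _).2 (hu x)⟩
  refine nontrivial_of_ne w 0 fun hw => ?_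
  have h₀ : u (Quotient.mk _ p₀) = 0 := congrArg (fun v => v (Quotient.mk _ p₀)) hw
  have h := hu' p₀
  rw [h₀, mul_zero] at h
  exact pow_ne_zero m (hs₀ z₀) h.symm

end

omit [FiniteDimensional ℂ V] in
theorem exists_latticeDegree_eq_one [Nontrivial V] [IsZLattice ℝ Γ] :
    ∃ γ : Γ, latticeDegree b γ = 1 := by
  classical
  -- An empty basis would make `Γ` zero, which cannot span a nonzero `V`; otherwise any basis vector
  -- has degree `1`.
  obtain h | ⟨⟨i⟩⟩ := isEmpty_or_nonempty ι
  · have hb : Subsingleton Γ := b.repr.toEquiv.subsingleton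
    have h₁ : (Γ : Set V) ⊆ {0} := fun v hv =>
      congrArg Subtype.val (Subsingleton.elim (⟨v, hv⟩ : Γ) 0)
    have h₂ := Submodule.span_mono (R := ℝ) h₁
    rw [IsZLattice.span_top, Submodule.span_zero_singleton, top_le_iff] at h₂
    exact absurd h₂ bot_ne_top
  · refine ⟨b i, ?_⟩
    simp [latticeDegree, Finsupp.single_apply]

end TwistedQuotientSections

/-! ### Existence and uniqueness of the multiplier, and the main theorem. -/

section CanonicalPullback

variable {E : Type*} [NormedAddCommGroup E] [NormedSpace ℂ E] [FiniteDimensional ℂ E]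
  {M : Type*} [TopologicalSpace M] [CompactSpace M] [ConnectedSpace M]
  [ChartedSpace E M] [IsManifold 𝓘(ℂ, E) ω M]

/-- The pullback of a nowhere zero holomorphic form of top degree on a compact connected complex
manifold is a constant multiple of it. -/
theorem existsUnique_jacobianDet_mul_eq (f : M ≃ₘ^ω⟮𝓘(ℂ, E), 𝓘(ℂ, E)⟯ M) {s : M → ℂ}
    (hs : ∀ x, IsHolomorphicPluricanonicalAt 𝓘(ℂ, E) 1 s x) (hs₀ : ∀ x, s x ≠ 0) :
    ∃! lam : ℂ, ∀ x, jacobianDet 𝓘(ℂ, E) f x * s (f x) = lam * s x := by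
  have hhol : ContMDiff 𝓘(ℂ, E) 𝓘(ℂ, ℂ) ω
      fun x => jacobianDet 𝓘(ℂ, E) f x ^ 1 * s (f x) / s x := fun x =>
    ((hs (f x)).pullback _ (f.contMDiff x)).div _ (hs x) (hs₀ x)
  obtain ⟨lam, hlam⟩ := (hhol.mdifferentiable (by simp)).exists_eq_const_of_compactSpace
  refine ⟨lam, fun x => ?_, fun mu hmu => ?_⟩
  · have h := congrFun hlam x
    rwa [pow_one, Function.const_apply, div_eq_iff (hs₀ x)] at h
  · obtain ⟨x⟩ := (inferInstance : Nonempty M)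
    have h := congrFun hlam x
    rw [pow_one, Function.const_apply, div_eq_iff (hs₀ x), hmu x] at h
    exact mul_right_cancel₀ (hs₀ x) h

end CanonicalPullback

theorem mainTheorem3
    {E : Type*} [NormedAddCommGroup E] [NormedSpace ℂ E] [FiniteDimensional ℂ E]
    {M : Type*} [TopologicalSpace M] [T2Space M] [CompactSpace M] [ConnectedSpace M]
    [ChartedSpace E M] [IsManifold 𝓘(ℂ, E) ω M]
    (f : M ≃ₘ^ω⟮𝓘(ℂ, E), 𝓘(ℂ, E)⟯ M)
    (σ : PluricanonicalSection 𝓘(ℂ, E) M 1) (hσ : ∀ x, σ x ≠ 0)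
    {V : Type*} [NormedAddCommGroup V] [NormedSpace ℂ V] [FiniteDimensional ℂ V] [Nontrivial V]
    (Γ : Submodule ℤ V) [DiscreteTopology Γ] [IsZLattice ℝ Γ]
    {ι : Type*} [Fintype ι] (b : Module.Basis ι ℤ Γ) :
    (∃! lam : ℂ, ∀ x, canonicalPullback f σ x = lam • σ x) ∧
    ∀ lam : ℂ, (∀ x, canonicalPullback f σ x = lam • σ x) →
      ‖lam‖ = 1 ∧
      ((∃ m : ℕ, 0 < m ∧ lam ^ m = 1) →
        kodairaDimension (𝓘(ℂ, E).prod 𝓘(ℂ, V)) (TwistedQuotient f b) = 0) ∧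
      ((¬ ∃ m : ℕ, 0 < m ∧ lam ^ m = 1) →
        kodairaDimension (𝓘(ℂ, E).prod 𝓘(ℂ, V)) (TwistedQuotient f b) = ⊥) := by
  set s : M → ℂ := fun x => σ x with hs_def
  have hs (x : M) : IsHolomorphicPluricanonicalAt 𝓘(ℂ, E) 1 s x :=
    (pluricanonicalSection_contMDiffAt_iff _).1 (σ.contMDiff x)
  refine ⟨existsUnique_jacobianDet_mul_eq f hs hσ, fun lam hf => ?_⟩
  replace hf : ∀ x, jacobianDet 𝓘(ℂ, E) f x * s (f x) = lam * s x := hf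
  have hnorm : ‖lam‖ = 1 := norm_eq_one_of_jacobianDet_mul_eq hs hσ f hf
  have hlam : lam ≠ 0 := by
    rintro rfl
    simp at hnorm
  refine ⟨hnorm, ?_, fun hroot => ?_⟩
  · rintro ⟨m, hm, hroot⟩
    have hnt := nontrivial_pluricanonicalSection f b hσ hlam hf hs hroot
    rw [kodairaDimension, if_neg fun h => not_subsingleton_iff_nontrivial.2 hnt (h m hm)]
    have h₀ : (⨅ k ∈ {k : ℕ | ∃ C : ℕ, ∀ m : ℕ, 1 ≤ m →
        Module.rank ℂ (PluricanonicalSection (𝓘(ℂ, E).prod 𝓘(ℂ, V)) (TwistedQuotient f b) m) ≤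
          ((C * m ^ k : ℕ) : Cardinal)}, (k : ℕ∞)) = 0 := by
      -- The exponent `0` is admissible with `C = 1`, since `P_m ≤ 1` for all `m`.
      refine le_antisymm (iInf₂_le (0 : ℕ) ⟨1, fun m _ => ?_⟩) zero_le
      simpa using rank_pluricanonicalSection_le_one f b hσ hlam hf hs hnorm m
    rw [h₀]
    rfl
  · obtain ⟨γ, hγ⟩ := exists_latticeDegree_eq_one b
    refine if_pos fun m hm => ?_
    exact subsingleton_pluricanonicalSection f b hσ hlam hf hs hnorm
      (fun h => hroot ⟨m, hm, h⟩) hγ
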